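/- Let $M$ be a compact smooth Riemannian surface (a compact two-dimensional manifold without boundary with a smooth Riemannian metric), let $T^1M$ be its unit tangent bundle, and let $(g_t)_{t\in\mathbb R}$ be the geodesic flow on $T^1M$. Suppose that $M$ contains an embedded flat cylinder, that is, a compact subset isometric (as a Riemannian surface with boundary) to the Euclidean cylinder $[0,l]\times\mathbb R/(2\pi h\mathbb Z)$ for some $l,h>0$. Let $\gamma:\mathbb R\to M$ be a periodic unit-speed geodesic, with $\gamma(t+T)=\gamma(t)$ for all $t$ and some $T>0$, whose image lies in the interior of the cylinder, i.e. in the subset corresponding to $(0,l)\times\mathbb R/(2\pi h\mathbb Z)$. Let $$\delta_\gamma=\frac1T\int_0^T \delta_{\dot\gamma(t)}\,dt$$ be the Dirac measure on the orbit of $\dot\gamma$, i.e. the flow-invariant Borel probability measure on $T^1M$ carried by that orbit. Then $\delta_\gamma$ does not belong to the closure, for the weak topology on the space of Borel probability measures on $T^1M$, of the set of ergodic $(g_t)$-invariant Borel probability measures whose support is all of $T^1M$. -/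

import Mathlib

open Set Filter Topology MeasureTheory Bundle
open scoped Manifold ContDiff

noncomputable section

namespace RiemannianSurface

/-- The model space of a surface: the euclidean plane. -/
abbrev Plane : Type := EuclideanSpace ℝ (Fin 2)

/-- The `i`-th vector of the standard basis of the plane. -/
def basisVec (i : Fin 2) : Plane := EuclideanSpace.single i (1 : ℝ)

variable {M : Type*} [TopologicalSpace M] [ChartedSpace Plane M]

section Geodesics

variable [RiemannianBundle (fun x : M => TangentSpace (𝓡 2) x)]

/-- The matrix `(g_ij)` of the Riemannian metric in the local coordinates given by the chart `e`,
at the point of `M` with coordinates `x` (meaningful for `x ∈ e.target`). -/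
def metricMatrix (e : OpenPartialHomeomorph M Plane) (x : Plane) : Matrix (Fin 2) (Fin 2) ℝ :=
  Matrix.of fun i j =>
    inner ℝ (mfderiv (𝓡 2) (𝓡 2) e.symm x (basisVec i) : TangentSpace (𝓡 2) (e.symm x))
      (mfderiv (𝓡 2) (𝓡 2) e.symm x (basisVec j) : TangentSpace (𝓡 2) (e.symm x))

/-- The partial derivative `∂_m g_ij` in the chart `e`. -/
def metricPartial (e : OpenPartialHomeomorph M Plane) (m i j : Fin 2) (x : Plane) : ℝ :=
  fderiv ℝ (fun y => metricMatrix e y i j) x (basisVec m)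

/-- The Christoffel symbol `Γ^k_ij` of the Levi-Civita connection in the chart `e`. -/
def christoffel (e : OpenPartialHomeomorph M Plane) (k i j : Fin 2) (x : Plane) : ℝ :=
  (1 / 2 : ℝ) * ∑ m, (metricMatrix e x)⁻¹ k m *
    (metricPartial e i m j x + metricPartial e j m i x - metricPartial e m i j x)

/-- The velocity vector at time `t` of a curve in `M`. -/
def curveDeriv (γ : ℝ → M) (t : ℝ) : TangentSpace (𝓡 2) (γ t) :=
  mfderiv 𝓘(ℝ, ℝ) (𝓡 2) γ t (1 : ℝ)

/-- `γ : ℝ → M` is a (complete) geodesic parametrized by arc length: it is a smooth unit-speed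
curve which satisfies the geodesic equation in all smooth local coordinates. -/
structure IsUnitSpeedGeodesic (γ : ℝ → M) : Prop where
  contMDiff : ContMDiff 𝓘(ℝ, ℝ) (𝓡 2) ∞ γ
  norm_curveDeriv : ∀ t : ℝ, ‖curveDeriv γ t‖ = 1
  geodesic_equation : ∀ e ∈ IsManifold.maximalAtlas (𝓡 2) ∞ M, ∀ t : ℝ, γ t ∈ e.source →
    ∀ k : Fin 2,
      iteratedDeriv 2 (fun s => e (γ s) k) t
        + ∑ i, ∑ j, christoffel e k i j (e (γ t))
          * deriv (fun s => e (γ s) i) t * deriv (fun s => e (γ s) j) t = 0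

variable (M) in
/-- The unit tangent bundle `T¹M`. -/
def UnitTangentBundle : Type _ :=
  {v : TangentBundle (𝓡 2) M // ‖v.2‖ = 1}

/-- The velocity vectors of a unit-speed geodesic, as a curve in `T¹M`. -/
def velocity {γ : ℝ → M} (hγ : IsUnitSpeedGeodesic γ) (t : ℝ) : UnitTangentBundle M :=
  ⟨⟨γ t, curveDeriv γ t⟩, hγ.norm_curveDeriv t⟩

open Classical in
/-- The geodesic flow `g_t` on `T¹M`: the vector `v` is sent to the velocity at time `t` of the
geodesic with velocity `v` at time `0`. (On a compact surface this geodesic exists and is unique,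
so that the value `v` in the second case is never used.) -/
def geodesicFlow (t : ℝ) (v : UnitTangentBundle M) : UnitTangentBundle M :=
  if h : ∃ γ : ℝ → M, ∃ hγ : IsUnitSpeedGeodesic γ, velocity hγ 0 = v then
    velocity h.choose_spec.choose t
  else v

end Geodesics

section Measures

variable [IsManifold (𝓡 2) ∞ M] [RiemannianBundle (fun x : M => TangentSpace (𝓡 2) x)]

instance : TopologicalSpace (UnitTangentBundle M) :=
  inferInstanceAs (TopologicalSpace {v : TangentBundle (𝓡 2) M // ‖v.2‖ = 1})

instance : MeasurableSpace (UnitTangentBundle M) := borel _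

instance : BorelSpace (UnitTangentBundle M) := ⟨rfl⟩

/-- The Borel probability measure `μ` on `T¹M` is invariant under the geodesic flow and ergodic:
the flow-invariant Borel sets have measure `0` or `1`. -/
structure IsInvariantErgodic (μ : ProbabilityMeasure (UnitTangentBundle M)) : Prop where
  invariant : ∀ t : ℝ, MeasurePreserving (geodesicFlow (M := M) t)
    (μ : Measure (UnitTangentBundle M)) (μ : Measure (UnitTangentBundle M))
  ergodic : ∀ A : Set (UnitTangentBundle M), MeasurableSet A →
    (∀ t : ℝ, geodesicFlow t ⁻¹' A = A) →
      (μ : Measure (UnitTangentBundle M)) A = 0 ∨ (μ : Measure (UnitTangentBundle M)) A = 1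

/-- The support of `μ` is the whole of `T¹M`. -/
def HasFullSupport (μ : ProbabilityMeasure (UnitTangentBundle M)) : Prop :=
  (μ : Measure (UnitTangentBundle M)).support = univ

theorem continuous_velocity {γ : ℝ → M} (hγ : IsUnitSpeedGeodesic γ) :
    Continuous (velocity hγ) := by
  have h1 : Continuous (tangentMap 𝓘(ℝ, ℝ) (𝓡 2) γ) :=
    hγ.contMDiff.continuous_tangentMap (by simp)
  have h2 : Continuous (fun t : ℝ => (⟨t, (1 : ℝ)⟩ : TangentBundle 𝓘(ℝ, ℝ) ℝ)) := by
    have := (tangentBundleModelSpaceHomeomorph 𝓘(ℝ, ℝ)).symm.continuous.comp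
      (show Continuous (fun t : ℝ => ((t, (1 : ℝ)) : ModelProd ℝ ℝ)) from
        Continuous.prodMk continuous_id continuous_const)
    exact this
  exact Continuous.subtype_mk (h1.comp h2) _

/-- The Dirac measure on the orbit of a closed geodesic `γ` with period `T`: the flow-invariant
probability measure carried by the orbit, that is, the image of the normalized Lebesgue measure
of a period by the velocity of `γ`. -/
def orbitMeasure {γ : ℝ → M} (hγ : IsUnitSpeedGeodesic γ) (T : ℝ) (hT : 0 < T) :
    ProbabilityMeasure (UnitTangentBundle M) :=
  ⟨Measure.map (velocity hγ) ((ENNReal.ofReal T)⁻¹ • (volume.restrict (Ioc 0 T))), by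
    have : IsProbabilityMeasure ((ENNReal.ofReal T)⁻¹ • ((volume : Measure ℝ).restrict (Ioc 0 T))) := by
      constructor
      simp only [Measure.smul_apply, Measure.restrict_apply MeasurableSet.univ, univ_inter,
        Real.volume_Ioc, sub_zero, smul_eq_mul]
      exact ENNReal.inv_mul_cancel (by simpa using hT) ENNReal.ofReal_ne_top
    exact Measure.isProbabilityMeasure_map (continuous_velocity hγ).measurable.aemeasurable⟩

end Measures

section Cylinder

/-- The strip `[0, l] × ℝ` in the plane, the universal cover of the cylinder
`[0, l] × ℝ / 2πhℤ`. -/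
def strip (l : ℝ) : Set Plane := {p | p 0 ∈ Icc 0 l}

variable (M) in
/-- An embedded flat cylinder in `M`: an isometric embedding in `M` of the euclidean cylinder
`[0, l] × ℝ / 2πhℤ`, with `l, h > 0`. The embedding is given as a map on the strip `[0, l] × ℝ`
which is smooth up to the boundary, preserves the inner products of tangent vectors, and
identifies two points exactly when they agree modulo `2πhℤ` in the second coordinate. -/
structure EmbeddedFlatCylinder [RiemannianBundle (fun x : M => TangentSpace (𝓡 2) x)] where
  l : ℝ
  h : ℝ
  l_pos : 0 < l
  h_pos : 0 < h
  toFun : Plane → M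
  contMDiffOn : ContMDiffOn (𝓡 2) (𝓡 2) ∞ toFun (strip l)
  eq_iff : ∀ p ∈ strip l, ∀ q ∈ strip l,
    toFun p = toFun q ↔ p 0 = q 0 ∧ ∃ n : ℤ, p 1 - q 1 = n * (2 * Real.pi * h)
  inner_mfderivWithin : ∀ p ∈ strip l, ∀ u w : Plane,
    inner ℝ (mfderivWithin (𝓡 2) (𝓡 2) toFun (strip l) p u : TangentSpace (𝓡 2) (toFun p))
      (mfderivWithin (𝓡 2) (𝓡 2) toFun (strip l) p w : TangentSpace (𝓡 2) (toFun p))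
      = inner ℝ u w

/-- The interior of an embedded flat cylinder: the image of `(0, l) × ℝ / 2πhℤ`. -/
def EmbeddedFlatCylinder.interior [RiemannianBundle (fun x : M => TangentSpace (𝓡 2) x)]
    (C : EmbeddedFlatCylinder M) : Set M :=
  C.toFun '' {p | p 0 ∈ Ioo 0 C.l}

end Cylinder

end RiemannianSurface

end

noncomputable section

namespace RiemannianSurface

variable {M : Type*} [TopologicalSpace M] [ChartedSpace Plane M]

/-! ### Flat charts on the cylinder -/

section Cylinder

variable [RiemannianBundle (fun x : M => TangentSpace (𝓡 2) x)]

/-! Over the interior of the cylinder a geodesic is a straight line, so its axial coordinate moves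
with constant velocity, the slope. A closed geodesic there has slope zero and stays on a circle
`coord = x`. The point is that an ergodic measure `μ` of full support cannot concentrate near this
circle: it gives mass at most `1 / 2` to the unit vectors over `|coord - x| < ε` once `x + 6 * ε <
l` (`measureReal_le_half`).

Vectors of slope zero form an invariant set that misses a nonempty open set, hence a null set
(`measure_slope_eq_zero`). The others are sorted into cells by the sign of the slope and its dyadic
size. Within one cell all axial speeds agree up to a factor two, so a single time carries the whole
cell out of the interval without leaving the cylinder. By invariance, the part of the cell over the
interval has at most the mass of the part off it (`measure_cell_le`). Summing over cells compares
the mass over the interval with that of its complement.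

The bound passes to weak limits through a continuous function supported near the circle, whereas the
orbit measure integrates that function to `1`. -/

lemma isOpen_openStrip (l : ℝ) : IsOpen {p : Plane | p 0 ∈ Ioo 0 l} :=
  isOpen_Ioo.preimage (by fun_prop)

lemma strip_mem_nhds {l : ℝ} {p : Plane} (hp : p 0 ∈ Ioo 0 l) : strip l ∈ 𝓝 p :=
  mem_of_superset ((isOpen_openStrip l).mem_nhds hp) fun _ h => Ioo_subset_Icc_self h

/-- The inner product of the images of two vectors under the differential depends only on the germ
of the map. -/
lemma inner_mfderiv_congr {f g : Plane → M} {x : Plane} (hfg : f =ᶠ[𝓝 x] g) (u w : Plane) :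
    inner ℝ (mfderiv (𝓡 2) (𝓡 2) f x u : TangentSpace (𝓡 2) (f x))
      (mfderiv (𝓡 2) (𝓡 2) f x w : TangentSpace (𝓡 2) (f x)) =
    inner ℝ (mfderiv (𝓡 2) (𝓡 2) g x u : TangentSpace (𝓡 2) (g x))
      (mfderiv (𝓡 2) (𝓡 2) g x w : TangentSpace (𝓡 2) (g x)) := by
  have h1 : f x = g x := hfg.eq_of_nhds
  have h2 : ∀ v : Plane, (mfderiv (𝓡 2) (𝓡 2) f x v : Plane) = mfderiv (𝓡 2) (𝓡 2) g x v :=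
    fun v => by rw [hfg.mfderiv_eq]; rfl
  -- The two inner products live in fibres over `f x` and `g x`; with the base point as a variable
  -- the equality of base points can be substituted.
  let F : (y : M) → TangentSpace (𝓡 2) y → TangentSpace (𝓡 2) y → ℝ := fun y a b => inner ℝ a b
  have key : ∀ (y z : M) (a b : Plane), y = z → F y a b = F z a b := by
    rintro y z a b rfl; rfl
  exact (key _ _ _ _ h1).trans (congrArg₂ (fun a b : Plane => F (g x) a b) (h2 u) (h2 w))

namespace EmbeddedFlatCylinder

variable (C : EmbeddedFlatCylinder M)

lemma inner_mfderiv {p : Plane} (hp : p 0 ∈ Ioo 0 C.l) (u w : Plane) :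
    inner ℝ (mfderiv (𝓡 2) (𝓡 2) C.toFun p u : TangentSpace (𝓡 2) (C.toFun p))
      (mfderiv (𝓡 2) (𝓡 2) C.toFun p w : TangentSpace (𝓡 2) (C.toFun p)) = inner ℝ u w := by
  have := C.inner_mfderivWithin p (Ioo_subset_Icc_self hp) u w
  rwa [mfderivWithin_of_mem_nhds (strip_mem_nhds hp)] at this

lemma contMDiffAt {p : Plane} (hp : p 0 ∈ Ioo 0 C.l) :
    ContMDiffAt (𝓡 2) (𝓡 2) ∞ C.toFun p :=
  C.contMDiffOn.contMDiffAt (strip_mem_nhds hp)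

lemma eq_zero_of_mfderiv_eq_zero {p : Plane} (hp : p 0 ∈ Ioo 0 C.l) {u : Plane}
    (hu : mfderiv (𝓡 2) (𝓡 2) C.toFun p u = 0) : u = 0 := by
  have := C.inner_mfderiv hp u u
  rw [hu, inner_zero_left] at this
  exact inner_self_eq_zero.mp this.symm

/-- In a flat cylinder the inverse of the isometric embedding gives local charts. -/
lemma exists_chart [IsManifold (𝓡 2) ∞ M] {p : Plane} (hp : p 0 ∈ Ioo 0 C.l) :
    ∃ e ∈ IsManifold.maximalAtlas (𝓡 2) ∞ M, C.toFun p ∈ e.source ∧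
      ∀ q ∈ e.target, q 0 ∈ Ioo 0 C.l ∧ e.symm q = C.toFun q := by
  classical
  set φ := chartAt Plane (C.toFun p) with hφ
  have hφm : φ ∈ IsManifold.maximalAtlas (𝓡 2) ∞ M := IsManifold.chart_mem_maximalAtlas _
  set S : Set Plane := {q | q 0 ∈ Ioo 0 C.l} ∩ C.toFun ⁻¹' φ.source with hS
  have hSo : IsOpen S := by
    have hc : ContinuousOn C.toFun {q | q 0 ∈ Ioo 0 C.l} :=
      fun q hq => (C.contMDiffAt hq).continuousAt.continuousWithinAt
    exact hc.isOpen_inter_preimage (isOpen_openStrip _) φ.open_source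
  set g : Plane → Plane := fun q => φ (C.toFun q) with hg
  have hgs : ∀ q ∈ S, ContDiffAt ℝ ∞ g q := fun q hq => by
    rw [← contMDiffAt_iff_contDiffAt]
    exact (contMDiffAt_of_mem_maximalAtlas hφm hq.2).comp q (C.contMDiffAt hq.1)
  -- The isometry has injective differential and factors locally as `φ.symm ∘ g`, so `g` has
  -- injective, hence invertible, differential. This is needed on all of `S`, to make the local
  -- inverse smooth on its whole domain and not only at one point.
  have hinv : ∀ q ∈ S, ∃ g' : Plane ≃L[ℝ] Plane, HasFDerivAt g (g' : Plane →L[ℝ] Plane) q := by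
    intro q hq
    have hd : HasFDerivAt g (fderiv ℝ g q) q :=
      ((hgs q hq).differentiableAt (by simp)).hasFDerivAt
    have hinj : Function.Injective (fderiv ℝ g q) := by
      rw [injective_iff_map_eq_zero]
      intro u hu
      apply C.eq_zero_of_mfderiv_eq_zero hq.1
      have heq : C.toFun =ᶠ[𝓝 q] φ.symm ∘ g := by
        filter_upwards [hSo.mem_nhds hq] with z hz
        exact (φ.left_inv hz.2).symm
      have h1 : MDifferentiableAt (𝓡 2) (𝓡 2) φ.symm (g q) :=
        (contMDiffAt_symm_of_mem_maximalAtlas hφm (φ.map_source hq.2)).mdifferentiableAt (by simp)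
      have h2 : MDifferentiableAt (𝓡 2) (𝓡 2) g q :=
        (contMDiffAt_iff_contDiffAt.mpr (hgs q hq)).mdifferentiableAt (by simp)
      have h3 := mfderiv_comp q h1 h2
      have h4 : mfderiv (𝓡 2) (𝓡 2) g q u = 0 := by rw [mfderiv_eq_fderiv]; exact hu
      rw [heq.mfderiv_eq, h3]
      exact (congrArg (mfderiv (𝓡 2) (𝓡 2) φ.symm (g q)) h4).trans (map_zero _)
    refine ⟨(LinearEquiv.ofInjectiveEndo (fderiv ℝ g q).toLinearMap hinj).toContinuousLinearEquiv,
      ?_⟩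
    convert hd using 1
    ext; rfl
  have hpS : p ∈ S := ⟨hp, mem_chart_source _ _⟩
  obtain ⟨g', hg'⟩ := hinv p hpS
  -- The local inverse comes from the inverse function theorem; restricting to `S` keeps its values
  -- in the open strip.
  set f := ((hgs p hpS).toOpenPartialHomeomorph g hg' (by simp)).restrOpen S hSo with hf
  have hfc : (f : Plane → Plane) = g := rfl
  have hfS : f.source ⊆ S := inter_subset_right
  have hpf : p ∈ f.source := ⟨(hgs p hpS).mem_toOpenPartialHomeomorph_source hg' (by simp), hpS⟩
  have hfsymm : ContDiffOn ℝ ∞ f.symm f.target := fun z hz => by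
    have hz' := f.map_target hz
    obtain ⟨G, hG⟩ := hinv _ (hfS hz')
    exact (f.contDiffAt_symm hz hG (hgs _ (hfS hz'))).contDiffWithinAt
  have htar : ∀ q ∈ (φ.trans f.symm).target, q ∈ f.source := fun q hq => hq.1
  have hval : ∀ q ∈ (φ.trans f.symm).target, (φ.trans f.symm).symm q = C.toFun q := fun q hq =>
    φ.left_inv (hfS (htar q hq)).2
  refine ⟨φ.trans f.symm, ?_, ?_, fun q hq => ⟨(hfS (htar q hq)).1, hval q hq⟩⟩
  · apply OpenPartialHomeomorph.mem_maximalAtlas_of_contMDiffOn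
    · exact (contMDiffOn_iff_contDiffOn.mpr hfsymm).comp
        ((contMDiffOn_of_mem_maximalAtlas hφm).mono inter_subset_left) inter_subset_right
    · intro q hq
      exact ((C.contMDiffAt (hfS (htar q hq)).1).contMDiffWithinAt).congr hval (hval q hq)
  · exact ⟨hpS.2, f.map_source hpf⟩

/-- A map which is locally the embedding of the flat cylinder has vanishing Christoffel symbols. -/
lemma christoffel_eq_zero {e : OpenPartialHomeomorph M Plane}
    (he : ∀ q ∈ e.target, q 0 ∈ Ioo 0 C.l ∧ e.symm q = C.toFun q) (k i j : Fin 2)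
    {x : Plane} (hx : x ∈ e.target) : christoffel e k i j x = 0 := by
  have hm : ∀ y ∈ e.target, ∀ i j, metricMatrix e y i j = inner ℝ (basisVec i) (basisVec j) := by
    intro y hy i j
    have h1 : e.symm =ᶠ[𝓝 y] C.toFun := by
      filter_upwards [e.open_target.mem_nhds hy] with z hz using (he z hz).2
    exact (inner_mfderiv_congr h1 _ _).trans (C.inner_mfderiv (he y hy).1 _ _)
  have hp : ∀ m i j, metricPartial e m i j x = 0 := by
    intro m i j
    have h1 : (fun y => metricMatrix e y i j) =ᶠ[𝓝 x]
        fun _ => inner ℝ (basisVec i) (basisVec j) := by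
      filter_upwards [e.open_target.mem_nhds hx] with z hz using hm z hz i j
    rw [metricPartial, h1.fderiv_eq]
    simp
  simp [christoffel, hp]

end EmbeddedFlatCylinder

end Cylinder

/-! ### Axial coordinate and axial velocity -/

section CylinderCoordinates

variable [RiemannianBundle (fun x : M => TangentSpace (𝓡 2) x)]

namespace EmbeddedFlatCylinder

variable (C : EmbeddedFlatCylinder M)

open Classical in
/-- The coordinate along the axis of a flat cylinder (with value `0` outside the cylinder). -/
def coord (m : M) : ℝ :=
  if h : ∃ p ∈ strip C.l, C.toFun p = m then h.choose 0 else 0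

/-- The component along the axis of a tangent vector over a flat cylinder. -/
def slope (v : TangentBundle (𝓡 2) M) : ℝ :=
  (mfderiv (𝓡 2) 𝓘(ℝ, ℝ) C.coord v.1 v.2 : ℝ)

lemma coord_apply {p : Plane} (hp : p ∈ strip C.l) : C.coord (C.toFun p) = p 0 := by
  have h : ∃ q ∈ strip C.l, C.toFun q = C.toFun p := ⟨p, hp, rfl⟩
  rw [coord, dif_pos h]
  exact ((C.eq_iff _ h.choose_spec.1 _ hp).mp h.choose_spec.2).1

lemma coord_mem_Ioo {m : M} (hm : m ∈ C.interior) : C.coord m ∈ Ioo 0 C.l := by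
  obtain ⟨p, hp, rfl⟩ := hm
  rwa [C.coord_apply (Ioo_subset_Icc_self hp)]

/-- A flat chart sends a point to one of its preimages in the strip, so its first component is the
axial coordinate. Smoothness of `coord` and openness of the interior follow from this. -/
lemma exists_chart_coord [IsManifold (𝓡 2) ∞ M] {m : M} (hm : m ∈ C.interior) :
    ∃ e ∈ IsManifold.maximalAtlas (𝓡 2) ∞ M, m ∈ e.source ∧ e.source ⊆ C.interior ∧
      (∀ z ∈ e.source, e z 0 = C.coord z) ∧
      ∀ q ∈ e.target, q 0 ∈ Ioo 0 C.l ∧ e.symm q = C.toFun q := by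
  obtain ⟨p, hp, rfl⟩ := hm
  obtain ⟨e, he, hpe, h⟩ := C.exists_chart hp
  have key : ∀ z ∈ e.source, e z 0 ∈ Ioo 0 C.l ∧ C.toFun (e z) = z := fun z hz =>
    ⟨(h _ (e.map_source hz)).1, by rw [← (h _ (e.map_source hz)).2, e.left_inv hz]⟩
  refine ⟨e, he, hpe, fun z hz => ⟨e z, (key z hz).1, (key z hz).2⟩, fun z hz => ?_, h⟩
  conv_rhs => rw [← (key z hz).2]
  exact (C.coord_apply (Ioo_subset_Icc_self (key z hz).1)).symm

lemma isOpen_interior [IsManifold (𝓡 2) ∞ M] : IsOpen C.interior :=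
  isOpen_iff_mem_nhds.mpr fun _ hm =>
    let ⟨e, _, hme, hsub, _⟩ := C.exists_chart_coord hm
    mem_of_superset (e.open_source.mem_nhds hme) hsub

lemma contMDiffAt_coord [IsManifold (𝓡 2) ∞ M] {m : M} (hm : m ∈ C.interior) :
    ContMDiffAt (𝓡 2) 𝓘(ℝ, ℝ) ∞ C.coord m := by
  obtain ⟨e, he, hme, -, hX, -⟩ := C.exists_chart_coord hm
  have h1 : ContMDiffAt (𝓡 2) (𝓡 2) ∞ e m := contMDiffAt_of_mem_maximalAtlas he hme
  have h2 : ContMDiff (𝓡 2) 𝓘(ℝ, ℝ) ∞ (fun p : Plane => p 0) := by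
    rw [contMDiff_iff_contDiff]
    fun_prop
  refine (h2.contMDiffAt.comp m h1).congr_of_eventuallyEq ?_
  filter_upwards [e.open_source.mem_nhds hme] with z hz using (hX z hz).symm

lemma isOpen_inter_coord_preimage [IsManifold (𝓡 2) ∞ M] {s : Set ℝ} (hs : IsOpen s) :
    IsOpen (C.interior ∩ C.coord ⁻¹' s) :=
  ContinuousOn.isOpen_inter_preimage
    (fun _ hm => (C.contMDiffAt_coord hm).continuousAt.continuousWithinAt) C.isOpen_interior hs

lemma continuousOn_slope [IsManifold (𝓡 2) ∞ M] :
    ContinuousOn C.slope (TotalSpace.proj ⁻¹' C.interior) := by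
  have h1 : ContMDiffOn (𝓡 2) 𝓘(ℝ, ℝ) ∞ C.coord C.interior :=
    fun m hm => (C.contMDiffAt_coord hm).contMDiffWithinAt
  have h2 := h1.continuousOn_tangentMapWithin (by simp) C.isOpen_interior.uniqueMDiffOn
  have h3 : Continuous fun w : TangentBundle 𝓘(ℝ, ℝ) ℝ => (w.2 : ℝ) :=
    continuous_snd.comp (tangentBundleModelSpaceHomeomorph 𝓘(ℝ, ℝ)).continuous
  refine (h3.comp_continuousOn h2).congr fun v hv => ?_
  simp only [Function.comp, tangentMapWithin, slope]
  rw [mfderivWithin_of_isOpen C.isOpen_interior hv]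

/-- The part of a flat cylinder over a compact interval of the axis is closed. -/
lemma isClosed_image_Icc [T2Space M] {a b : ℝ} (ha : 0 ≤ a) (hb : b ≤ C.l) :
    IsClosed (C.toFun '' {p | p 0 ∈ Icc a b}) := by
  have hP : 0 < 2 * Real.pi * C.h := mul_pos (by positivity) C.h_pos
  set K : Set Plane := {p | p 0 ∈ Icc a b ∧ p 1 ∈ Icc 0 (2 * Real.pi * C.h)} with hK
  have hKc : IsCompact K := by
    have h1 : IsCompact ((EuclideanSpace.equiv (Fin 2) ℝ).symm ''
        (Set.pi univ ![Icc a b, Icc 0 (2 * Real.pi * C.h)])) := by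
      refine (isCompact_univ_pi fun i => ?_).image (by fun_prop)
      fin_cases i <;> simp [isCompact_Icc]
    convert h1 using 1
    ext p
    constructor
    · rintro ⟨h0, h1⟩
      refine ⟨EuclideanSpace.equiv (Fin 2) ℝ p, ?_, by simp⟩
      intro i _
      fin_cases i
      · exact h0
      · exact h1
    · rintro ⟨q, hq, rfl⟩
      exact ⟨hq 0 trivial, hq 1 trivial⟩
  have hKs : K ⊆ strip C.l := fun p hp => ⟨ha.trans hp.1.1, hp.1.2.trans hb⟩
  have heq : C.toFun '' {p | p 0 ∈ Icc a b} = C.toFun '' K := by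
    refine Subset.antisymm ?_ (image_mono fun p hp => hp.1)
    rintro _ ⟨p, hp, rfl⟩
    -- Translating by whole periods brings the point into the compact fundamental domain `K`.
    set n : ℤ := ⌊p 1 / (2 * Real.pi * C.h)⌋
    have hn1 : n * (2 * Real.pi * C.h) ≤ p 1 := (le_div_iff₀ hP).mp (Int.floor_le _)
    have hn2 : p 1 < (n + 1) * (2 * Real.pi * C.h) := (div_lt_iff₀ hP).mp (Int.lt_floor_add_one _)
    refine ⟨!₂[p 0, p 1 - n * (2 * Real.pi * C.h)], ⟨by simpa using hp, ?_⟩, ?_⟩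
    · simp only [Matrix.cons_val_one, Matrix.cons_val_fin_one]
      constructor <;> linarith
    · refine (C.eq_iff _ ?_ _ ?_).mpr ⟨by simp, -n, by simp⟩
      · exact ⟨ha.trans (by simpa using hp.1), le_trans (by simpa using hp.2) hb⟩
      · exact ⟨ha.trans hp.1, hp.2.trans hb⟩
  rw [heq]
  exact (hKc.image_of_continuousOn (C.contMDiffOn.continuousOn.mono hKs)).isClosed

/-- The tangent vector at `C.toFun p` that corresponds to the vector `u` of the plane. -/
def tangentVector (p u : Plane) : TangentBundle (𝓡 2) M :=
  ⟨C.toFun p, mfderiv (𝓡 2) (𝓡 2) C.toFun p u⟩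

lemma norm_tangentVector {p : Plane} (hp : p 0 ∈ Ioo 0 C.l) (u : Plane) :
    ‖(C.tangentVector p u).2‖ = ‖u‖ := by
  have h := C.inner_mfderiv hp u u
  rw [real_inner_self_eq_norm_sq, real_inner_self_eq_norm_sq] at h
  exact (sq_eq_sq₀ (norm_nonneg _) (norm_nonneg _)).mp h

/-- Chain rule for `coord ∘ toFun`, which is the first coordinate near `p`. -/
lemma slope_tangentVector [IsManifold (𝓡 2) ∞ M] {p : Plane} (hp : p 0 ∈ Ioo 0 C.l) (u : Plane) :
    C.slope (C.tangentVector p u) = u 0 := by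
  have h1 : MDifferentiableAt (𝓡 2) 𝓘(ℝ, ℝ) C.coord (C.toFun p) :=
    (C.contMDiffAt_coord ⟨p, hp, rfl⟩).mdifferentiableAt (by simp)
  have h2 := (C.contMDiffAt hp).mdifferentiableAt (by simp)
  have h3 : C.coord ∘ C.toFun =ᶠ[𝓝 p] fun q : Plane => q 0 := by
    filter_upwards [strip_mem_nhds hp] with q hq using C.coord_apply hq
  have h4 := mfderiv_comp p h1 h2
  rw [h3.mfderiv_eq, mfderiv_eq_fderiv] at h4
  have h5 : fderiv ℝ (fun q : Plane => q 0) p u = u 0 := by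
    have := (EuclideanSpace.proj (𝕜 := ℝ) (0 : Fin 2) : Plane →L[ℝ] ℝ).fderiv (x := p)
    exact congrArg (fun A : Plane →L[ℝ] ℝ => A u) this
  rw [← h5]
  exact (congrArg (fun A : Plane →L[ℝ] ℝ => A u) h4).symm

end EmbeddedFlatCylinder

end CylinderCoordinates

/-! ### Straightness of geodesics in the cylinder -/

section GeodesicsInCylinder

variable [RiemannianBundle (fun x : M => TangentSpace (𝓡 2) x)] [IsManifold (𝓡 2) ∞ M]

namespace IsUnitSpeedGeodesic

variable {γ : ℝ → M} (C : EmbeddedFlatCylinder M)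

lemma hasDerivAt_coord (hγ : IsUnitSpeedGeodesic γ) {t : ℝ} (ht : γ t ∈ C.interior) :
    HasDerivAt (fun s => C.coord (γ s)) (C.slope ⟨γ t, curveDeriv γ t⟩) t := by
  have h1 := ((C.contMDiffAt_coord ht).mdifferentiableAt (by simp)).hasMFDerivAt
  have h2 := ((hγ.contMDiff t).mdifferentiableAt (by simp)).hasMFDerivAt
  have key : ∀ A : ℝ →L[ℝ] ℝ, HasFDerivAt (fun s => C.coord (γ s)) A t →
      HasDerivAt (fun s => C.coord (γ s)) (A 1) t := fun A h => h.hasDerivAt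
  exact key _ (h1.comp t h2).hasFDerivAt

lemma eventually_mem_interior (hγ : IsUnitSpeedGeodesic γ) {t : ℝ} (ht : γ t ∈ C.interior) : ∀ᶠ s in 𝓝 t, γ s ∈ C.interior :=
  hγ.contMDiff.continuous.continuousAt.eventually_mem (C.isOpen_interior.mem_nhds ht)

/-- The axial velocity of a geodesic in a flat cylinder is locally constant. -/
lemma hasDerivAt_slope (hγ : IsUnitSpeedGeodesic γ) {t : ℝ} (ht : γ t ∈ C.interior) :
    HasDerivAt (fun s => C.slope ⟨γ s, curveDeriv γ s⟩) 0 t := by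
  obtain ⟨e, he, hte, -, hX, hflat⟩ := C.exists_chart_coord ht
  have hev : ∀ᶠ s in 𝓝 t, γ s ∈ e.source :=
    hγ.contMDiff.continuous.continuousAt.eventually_mem (e.open_source.mem_nhds hte)
  -- In a flat chart the Christoffel symbols vanish, so the equation for the axial component `0`
  -- says that its second derivative is zero.
  have hgeo := hγ.geodesic_equation e he t hte 0
  simp only [C.christoffel_eq_zero hflat _ _ _ (e.map_source hte), zero_mul,
    Finset.sum_const_zero, add_zero] at hgeo
  have hfX : (fun s => e (γ s) 0) =ᶠ[𝓝 t] fun s => C.coord (γ s) := by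
    filter_upwards [hev] with s hs using hX _ hs
  have hsm : ContDiffAt ℝ ∞ (fun s => C.coord (γ s)) t :=
    contMDiffAt_iff_contDiffAt.mp ((C.contMDiffAt_coord ht).comp t (hγ.contMDiff t))
  have hd : DifferentiableAt ℝ (deriv fun s => C.coord (γ s)) t := by
    have h1 : ContDiffAt ℝ 1 (fderiv ℝ fun s => C.coord (γ s)) t :=
      hsm.fderiv_right (m := 1) (WithTop.coe_le_coe.mpr (le_top (a := (2 : ℕ∞))))
    exact (h1.differentiableAt (by simp)).clm_apply (differentiableAt_const 1)
  have h0 : deriv (deriv fun s => C.coord (γ s)) t = 0 := by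
    rw [hfX.iteratedDeriv_eq] at hgeo
    rwa [iteratedDeriv_succ, iteratedDeriv_one] at hgeo
  have := hd.hasDerivAt
  rw [h0] at this
  refine this.congr_of_eventuallyEq ?_
  filter_upwards [hγ.eventually_mem_interior C ht] with s hs
    using (hγ.hasDerivAt_coord C hs).deriv.symm

/-- On a ball of times spent over the interior, the slope and then the difference between `coord`
and its affine candidate have zero derivative. -/
lemma eventually_affine (hγ : IsUnitSpeedGeodesic γ) {t : ℝ} (ht : γ t ∈ C.interior) :
    ∀ᶠ s in 𝓝 t, γ s ∈ C.interior ∧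
      C.coord (γ s) = C.coord (γ t) + (s - t) * C.slope ⟨γ t, curveDeriv γ t⟩ ∧
      C.slope ⟨γ s, curveDeriv γ s⟩ = C.slope ⟨γ t, curveDeriv γ t⟩ := by
  obtain ⟨r, hr, hball⟩ := Metric.eventually_nhds_iff_ball.mp (hγ.eventually_mem_interior C ht)
  have hpc : IsPreconnected (Metric.ball t r) := (convex_ball t r).isPreconnected
  have htb := Metric.mem_ball_self (x := t) hr
  have hs1 : ∀ s ∈ Metric.ball t r,
      C.slope ⟨γ s, curveDeriv γ s⟩ = C.slope ⟨γ t, curveDeriv γ t⟩ := fun s hs =>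
    Metric.isOpen_ball.is_const_of_deriv_eq_zero
      (f := fun s => C.slope ⟨γ s, curveDeriv γ s⟩) hpc
      (fun u hu => (hγ.hasDerivAt_slope C (hball u hu)).differentiableAt.differentiableWithinAt)
      (fun u hu => (hγ.hasDerivAt_slope C (hball u hu)).deriv) hs htb
  have hs2 : ∀ u ∈ Metric.ball t r, HasDerivAt
      (fun s => C.coord (γ s) - (s - t) * C.slope ⟨γ t, curveDeriv γ t⟩) 0 u := fun u hu => by
    have := (hγ.hasDerivAt_coord C (hball u hu)).sub
      (((hasDerivAt_id u).sub_const t).mul_const (C.slope ⟨γ t, curveDeriv γ t⟩))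
    rw [hs1 u hu] at this
    rw [one_mul, sub_self] at this
    exact this
  filter_upwards [Metric.ball_mem_nhds t hr] with s hs
  refine ⟨hball s hs, ?_, hs1 s hs⟩
  have := Metric.isOpen_ball.is_const_of_deriv_eq_zero hpc
    (fun u hu => (hs2 u hu).differentiableAt.differentiableWithinAt)
    (fun u hu => (hs2 u hu).deriv) hs htb
  simp only [sub_self, zero_mul, sub_zero] at this
  linarith

/-- Inside a flat cylinder a geodesic moves along the axis with constant velocity. -/
lemma affine [T2Space M] (hγ : IsUnitSpeedGeodesic γ) {t₀ t : ℝ} (h₀ : γ t₀ ∈ C.interior)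
    (ht : C.coord (γ t₀) + (t - t₀) * C.slope ⟨γ t₀, curveDeriv γ t₀⟩ ∈ Ioo 0 C.l) :
    γ t ∈ C.interior ∧
      C.coord (γ t) = C.coord (γ t₀) + (t - t₀) * C.slope ⟨γ t₀, curveDeriv γ t₀⟩ ∧
      C.slope ⟨γ t, curveDeriv γ t⟩ = C.slope ⟨γ t₀, curveDeriv γ t₀⟩ := by
  set x := C.coord (γ t₀) with hx
  set σ := C.slope ⟨γ t₀, curveDeriv γ t₀⟩ with hσ
  set P : Set ℝ := {s | γ s ∈ C.interior ∧ C.coord (γ s) = x + (s - t₀) * σ ∧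
    C.slope ⟨γ s, curveDeriv γ s⟩ = σ} with hP
  have hPo : IsOpen P := isOpen_iff_mem_nhds.mpr fun s ⟨h1, h2, h3⟩ => by
    filter_upwards [hγ.eventually_affine C h1] with u ⟨k1, k2, k3⟩
    exact ⟨k1, by rw [k2, h2, h3]; ring, k3.trans h3⟩
  have hseg : ∀ s ∈ uIcc t₀ t, x + (s - t₀) * σ ∈ Ioo 0 C.l := by
    intro s hs
    rw [← segment_eq_uIcc] at hs
    obtain ⟨a, b, ha, hb, hab, rfl⟩ := hs
    have h1 := (convex_Ioo 0 C.l) (C.coord_mem_Ioo h₀) ht ha hb hab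
    convert h1 using 1
    simp only [smul_eq_mul]
    have : a = 1 - b := by linarith
    subst this
    ring
  suffices uIcc t₀ t ⊆ P from this right_mem_uIcc
  -- Connectedness: `P` is open and contains `t₀`, so it is enough that limit points of `P` in the
  -- time interval lie in `P`.
  refine isPreconnected_uIcc.subset_of_closure_inter_subset hPo
    ⟨t₀, left_mem_uIcc, h₀, by simp [hx], rfl⟩ ?_
  rintro s ⟨hs, hst⟩
  have hfr : ∃ᶠ u in 𝓝 s, u ∈ P := mem_closure_iff_frequently.mp hs
  have hmem := hseg s hst
  have hcl : Tendsto (fun u => x + (u - t₀) * σ) (𝓝 s) (𝓝 (x + (s - t₀) * σ)) :=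
    (by fun_prop : Continuous fun u => x + (u - t₀) * σ).tendsto s
  -- The affine value at `s` lies strictly inside `(0, l)`. Points of `P` near `s` thus lie over a
  -- compact `[a, b] ⊆ (0, l)`, whose closed image also contains `γ s`: the limit cannot reach the
  -- boundary.
  obtain ⟨a, ha0, has⟩ := exists_between hmem.1
  obtain ⟨b, hsb, hbl⟩ := exists_between hmem.2
  have h1 : γ s ∈ C.interior := by
    have hK : γ s ∈ C.toFun '' {p | p 0 ∈ Icc a b} := by
      refine (C.isClosed_image_Icc ha0.le hbl.le).mem_of_frequently_of_tendsto ?_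
        (hγ.contMDiff.continuous.tendsto s)
      refine (hfr.and_eventually (hcl.eventually_mem (Icc_mem_nhds has hsb))).mono ?_
      rintro u ⟨⟨⟨p, hp, hpu⟩, h2, -⟩, hu⟩
      refine ⟨p, ?_, hpu⟩
      rw [← hpu, C.coord_apply (Ioo_subset_Icc_self hp)] at h2
      rw [mem_ofPred_eq, h2]
      exact hu
    obtain ⟨p, hp, hps⟩ := hK
    exact ⟨p, ⟨ha0.trans_le hp.1, hp.2.trans_lt hbl⟩, hps⟩
  refine ⟨h1, ?_, ?_⟩
  · exact tendsto_nhds_unique_of_frequently_eq (hγ.hasDerivAt_coord C h1).continuousAt.tendsto hcl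
      (hfr.mono fun u hu => hu.2.1)
  · exact tendsto_nhds_unique_of_frequently_eq (hγ.hasDerivAt_slope C h1).continuousAt.tendsto
      tendsto_const_nhds (hfr.mono fun u hu => hu.2.2)

end IsUnitSpeedGeodesic

end GeodesicsInCylinder

/-! ### The geodesic flow and the cells -/

section Flow

variable [RiemannianBundle (fun x : M => TangentSpace (𝓡 2) x)]

lemma curveDeriv_comp_add_const {γ : ℝ → M} (hγ : IsUnitSpeedGeodesic γ) (a s : ℝ) :
    (curveDeriv (fun r => γ (r + a)) s : Plane) = curveDeriv γ (s + a) := by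
  have h1 : MDifferentiableAt 𝓘(ℝ, ℝ) (𝓡 2) γ (s + a) :=
    (hγ.contMDiff _).mdifferentiableAt (by simp)
  have h0 : HasFDerivAt (fun r : ℝ => r + a) (ContinuousLinearMap.id ℝ ℝ) s :=
    (hasFDerivAt_id s).add_const a
  have h2 := (h1.hasMFDerivAt.comp s h0.hasMFDerivAt).mfderiv
  exact congrArg (fun A : ℝ →L[ℝ] Plane => A 1) h2

lemma IsUnitSpeedGeodesic.comp_add_const {γ : ℝ → M} (hγ : IsUnitSpeedGeodesic γ) (a : ℝ) :
    IsUnitSpeedGeodesic fun r => γ (r + a) where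
  contMDiff := hγ.contMDiff.comp
    (contMDiff_iff_contDiff.mpr (contDiff_id.add contDiff_const))
  norm_curveDeriv t := by
    have h : (curveDeriv (fun r => γ (r + a)) t : TangentSpace (𝓡 2) (γ (t + a))) =
      curveDeriv γ (t + a) := curveDeriv_comp_add_const hγ a t
    rw [← hγ.norm_curveDeriv (t + a), ← h]
  geodesic_equation e he t ht k := by
    have h := hγ.geodesic_equation e he (t + a) ht k
    have h1 : ∀ i, deriv (fun s => e (γ (s + a)) i) t = deriv (fun s => e (γ s) i) (t + a) :=
      fun i => deriv_comp_add_const (fun s => e (γ s) i) a t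
    have h2 : iteratedDeriv 2 (fun s => e (γ (s + a)) k) t =
        iteratedDeriv 2 (fun s => e (γ s) k) (t + a) :=
      congrFun (iteratedDeriv_comp_add_const 2 (fun s => e (γ s) k) a) t
    simpa only [h1, h2] using h

lemma velocity_comp_add_const {γ : ℝ → M} (hγ : IsUnitSpeedGeodesic γ) (a s : ℝ) :
    velocity (hγ.comp_add_const a) s = velocity hγ (s + a) := by
  apply Subtype.ext
  exact congrArg (TotalSpace.mk (γ (s + a))) (curveDeriv_comp_add_const hγ a s)

/-- The unit vectors which are tangent to a complete geodesic. -/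
def IsGeodesicVector (v : UnitTangentBundle M) : Prop :=
  ∃ γ : ℝ → M, ∃ hγ : IsUnitSpeedGeodesic γ, velocity hγ 0 = v

/-- The geodesic chosen in `geodesicFlow` depends on `v` but not on `t`, so one geodesic serves all
times and uniqueness of geodesics is never invoked. -/
lemma IsGeodesicVector.exists_flow_eq {v : UnitTangentBundle M} (hv : IsGeodesicVector v) :
    ∃ γ : ℝ → M, ∃ hγ : IsUnitSpeedGeodesic γ, velocity hγ 0 = v ∧
      ∀ t, geodesicFlow t v = velocity hγ t :=
  ⟨hv.choose, hv.choose_spec.choose, hv.choose_spec.choose_spec, fun _ => dif_pos hv⟩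

lemma geodesicFlow_of_not_isGeodesicVector {v : UnitTangentBundle M} (hv : ¬ IsGeodesicVector v)
    (t : ℝ) : geodesicFlow t v = v :=
  dif_neg hv

lemma isGeodesicVector_velocity {γ : ℝ → M} (hγ : IsUnitSpeedGeodesic γ) (t : ℝ) :
    IsGeodesicVector (velocity hγ t) :=
  ⟨_, hγ.comp_add_const t, by rw [velocity_comp_add_const, zero_add]⟩

lemma isGeodesicVector_geodesicFlow {v : UnitTangentBundle M} {t : ℝ} :
    IsGeodesicVector (geodesicFlow t v) ↔ IsGeodesicVector v := by
  by_cases hv : IsGeodesicVector v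
  · obtain ⟨γ, hγ, -, h⟩ := hv.exists_flow_eq
    rw [h t]
    exact iff_of_true (isGeodesicVector_velocity hγ t) hv
  · rw [geodesicFlow_of_not_isGeodesicVector hv]

/-- A set of vectors not tangent to any complete geodesic is invariant. -/
lemma geodesicFlow_preimage_eq {F : Set (UnitTangentBundle M)}
    (hF : ∀ v ∈ F, ¬ IsGeodesicVector v) (t : ℝ) : geodesicFlow t ⁻¹' F = F := by
  ext v
  by_cases hv : IsGeodesicVector v
  · exact iff_of_false (fun h => hF _ h (isGeodesicVector_geodesicFlow.mpr hv))
      (fun h => hF _ h hv)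
  · rw [mem_preimage, geodesicFlow_of_not_isGeodesicVector hv]

namespace EmbeddedFlatCylinder

variable (C : EmbeddedFlatCylinder M)

/-- The unit vectors over the interior of a flat cylinder. -/
def unitVectors : Set (UnitTangentBundle M) := {v | v.1.proj ∈ C.interior}

/-- The unit vectors over the part `coord ∈ s` of a flat cylinder whose axial component has sign
`i.2` and absolute value of order `2 ^ i.1`. -/
def cell (s : Set ℝ) (i : ℤ × ℤˣ) : Set (UnitTangentBundle M) :=
  {v ∈ C.unitVectors | C.coord v.1.proj ∈ s ∧
    ((i.2 : ℤ) : ℝ) * C.slope v.1 ∈ Ioc ((2 : ℝ) ^ i.1) (2 ^ (i.1 + 1))}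

lemma pairwise_disjoint_cell (s : Set ℝ) : Pairwise (Function.onFun Disjoint (C.cell s)) := by
  rintro ⟨k, σ⟩ ⟨k', σ'⟩ hne
  refine disjoint_left.mpr ?_
  rintro v ⟨-, -, h⟩ ⟨-, -, h'⟩
  simp only at h h'
  have hpos := (zpow_pos (two_pos (α := ℝ)) k).trans h.1
  have hpos' := (zpow_pos (two_pos (α := ℝ)) k').trans h'.1
  have hσ : σ = σ' := by
    rcases Int.units_eq_one_or σ with rfl | rfl <;>
      rcases Int.units_eq_one_or σ' with rfl | rfl <;> simp at hpos hpos' ⊢ <;> linarith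
  subst hσ
  have h1 := (zpow_lt_zpow_iff_right₀ (one_lt_two (α := ℝ))).mp (h.1.trans_le h'.2)
  have h2 := (zpow_lt_zpow_iff_right₀ (one_lt_two (α := ℝ))).mp (h'.1.trans_le h.2)
  have : k = k' := by omega
  exact hne (by rw [this])

/-- A unit vector over a flat cylinder is orthogonal to the axis or belongs to a cell. -/
lemma mem_cell_of_slope_ne_zero {s : Set ℝ} {v : UnitTangentBundle M} (hv : v ∈ C.unitVectors)
    (hs : C.coord v.1.proj ∈ s) (h0 : C.slope v.1 ≠ 0) : ∃ i, v ∈ C.cell s i := by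
  obtain ⟨σ, hσ⟩ : ∃ σ : ℤˣ, 0 < ((σ : ℤ) : ℝ) * C.slope v.1 := by
    rcases lt_or_gt_of_ne h0 with h | h
    · exact ⟨-1, by simpa using h⟩
    · exact ⟨1, by simpa using h⟩
  obtain ⟨k, hk⟩ := exists_mem_Ioc_zpow hσ (one_lt_two (α := ℝ))
  exact ⟨(k, σ), hv, hs, hk⟩

end EmbeddedFlatCylinder

end Flow

/-! ### Ergodic measures of full support over the cylinder -/

section Measures

variable [IsManifold (𝓡 2) ∞ M] [RiemannianBundle (fun x : M => TangentSpace (𝓡 2) x)]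

lemma continuous_basePoint : Continuous fun v : UnitTangentBundle M => v.1.proj :=
  (FiberBundle.continuous_proj Plane _).comp continuous_subtype_val

lemma HasFullSupport.pos_of_isOpen {μ : ProbabilityMeasure (UnitTangentBundle M)}
    (hμ : HasFullSupport μ) {W : Set (UnitTangentBundle M)} (hW : IsOpen W) (hne : W.Nonempty) :
    0 < (μ : Measure (UnitTangentBundle M)) W := by
  obtain ⟨v, hv⟩ := hne
  exact (Measure.mem_support_iff_forall v).mp (by rw [hμ]; trivial) W (hW.mem_nhds hv)

/-- By ergodicity the alternative is full measure, which would make the nonempty open set `W` null.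
-/
lemma measure_eq_zero_of_disjoint {μ : ProbabilityMeasure (UnitTangentBundle M)}
    (hμ : IsInvariantErgodic μ) (hμ' : HasFullSupport μ) {F W : Set (UnitTangentBundle M)}
    (hF : MeasurableSet F) (hinv : ∀ t : ℝ, geodesicFlow t ⁻¹' F = F) (hW : IsOpen W)
    (hne : W.Nonempty) (hd : Disjoint F W) : (μ : Measure (UnitTangentBundle M)) F = 0 := by
  refine (hμ.ergodic F hF hinv).resolve_right fun h => ?_
  have h1 : (μ : Measure (UnitTangentBundle M)) Fᶜ = 0 := (prob_compl_eq_zero_iff hF).mpr h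
  exact (hμ'.pos_of_isOpen hW hne).ne' (measure_mono_null hd.subset_compl_left h1)

/-- Meant for `coord` and `slope`, whose continuity is established only over the interior of the
cylinder. -/
lemma measurableSet_inter_preimage {Y : Type*} [TopologicalSpace Y] [MeasurableSpace Y]
    [BorelSpace Y] {O : Set Y} (hO : IsOpen O) {f : Y → ℝ} (hf : ContinuousOn f O) {s : Set ℝ}
    (hs : MeasurableSet s) : MeasurableSet (O ∩ f ⁻¹' s) := by
  have h := (continuousOn_iff_continuous_domRestrict.mp hf).measurable hs
  convert hO.measurableSet.subtype_image h using 1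
  ext y
  simp [and_comm]

namespace EmbeddedFlatCylinder

variable (C : EmbeddedFlatCylinder M)

lemma isOpen_unitVectors : IsOpen C.unitVectors := C.isOpen_interior.preimage continuous_basePoint

lemma continuousOn_slope_unitVectors :
    ContinuousOn (fun v : UnitTangentBundle M => C.slope v.1) C.unitVectors :=
  C.continuousOn_slope.comp continuous_subtype_val.continuousOn fun _ h => h

lemma continuousOn_coord_unitVectors :
    ContinuousOn (fun v : UnitTangentBundle M => C.coord v.1.proj) C.unitVectors := fun _ hv =>
  (ContinuousAt.comp (f := fun v : UnitTangentBundle M => v.1.proj)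
    (C.contMDiffAt_coord hv).continuousAt
    continuous_basePoint.continuousAt).continuousWithinAt

lemma exists_unitVector (σ : ℤˣ) : ∃ v ∈ C.unitVectors, C.slope v.1 = (σ : ℤ) := by
  set p : Plane := EuclideanSpace.single 0 (C.l / 2)
  have hp : p 0 ∈ Ioo 0 C.l := by
    have := C.l_pos
    constructor <;> simp [p] <;> linarith
  set u : Plane := EuclideanSpace.single 0 (((σ : ℤ) : ℝ))
  have hu : ‖u‖ = 1 := by
    rcases Int.units_eq_one_or σ with rfl | rfl <;> simp [u]
  refine ⟨⟨C.tangentVector p u, (C.norm_tangentVector hp u).trans hu⟩, ⟨p, hp, rfl⟩, ?_⟩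
  rw [C.slope_tangentVector hp]
  simp [u]

lemma isOpen_pos_slope (σ : ℤˣ) :
    IsOpen {v ∈ C.unitVectors | 0 < ((σ : ℤ) : ℝ) * C.slope v.1} :=
  (continuousOn_const.mul C.continuousOn_slope_unitVectors).isOpen_inter_preimage
    C.isOpen_unitVectors isOpen_Ioi

lemma nonempty_pos_slope (σ : ℤˣ) :
    {v ∈ C.unitVectors | 0 < ((σ : ℤ) : ℝ) * C.slope v.1}.Nonempty := by
  obtain ⟨v, hv, h⟩ := C.exists_unitVector σ
  refine ⟨v, hv, ?_⟩
  rw [h]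
  rcases Int.units_eq_one_or σ with rfl | rfl <;> simp

lemma measurableSet_cell {s : Set ℝ} (hs : MeasurableSet s) (i : ℤ × ℤˣ) :
    MeasurableSet (C.cell s i) := by
  have h1 := measurableSet_inter_preimage C.isOpen_unitVectors C.continuousOn_coord_unitVectors hs
  have h2 := measurableSet_inter_preimage C.isOpen_unitVectors
    ((continuousOn_const (c := ((i.2 : ℤ) : ℝ))).mul C.continuousOn_slope_unitVectors)
    (measurableSet_Ioc (a := (2 : ℝ) ^ i.1) (b := 2 ^ (i.1 + 1)))
  convert h1.inter h2 using 1
  ext v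
  simp only [cell, mem_inter_iff, mem_preimage, mem_ofPred_eq]
  tauto

variable [T2Space M] {μ : ProbabilityMeasure (UnitTangentBundle M)}

/-- The closed geodesics of a flat cylinder are negligible for an ergodic measure of full
support. -/
lemma measure_slope_eq_zero (hμ : IsInvariantErgodic μ) (hμ' : HasFullSupport μ) :
    (μ : Measure (UnitTangentBundle M)) {v ∈ C.unitVectors | C.slope v.1 = 0} = 0 := by
  refine measure_eq_zero_of_disjoint hμ hμ' ?_ ?_ (C.isOpen_pos_slope 1) (C.nonempty_pos_slope 1) ?_
  · exact measurableSet_inter_preimage C.isOpen_unitVectors C.continuousOn_slope_unitVectors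
      (measurableSet_singleton 0)
  · intro t
    ext v
    by_cases hv : IsGeodesicVector v
    · obtain ⟨γ, hγ, rfl, hflow⟩ := hv.exists_flow_eq
      -- With slope zero the affine position is constant, so the geodesic stays over the interior,
      -- with slope zero, for all times.
      have key : ∀ a b : ℝ, velocity hγ a ∈ {v ∈ C.unitVectors | C.slope v.1 = 0} →
          velocity hγ b ∈ {v ∈ C.unitVectors | C.slope v.1 = 0} := by
        rintro a b ⟨h1, h2 : C.slope ⟨γ a, curveDeriv γ a⟩ = 0⟩
        have h3 := hγ.affine C (t₀ := a) (t := b) h1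
        rw [h2, mul_zero, add_zero] at h3
        obtain ⟨h4, -, h5⟩ := h3 (C.coord_mem_Ioo h1)
        exact ⟨h4, h5⟩
      rw [mem_preimage, hflow]
      exact ⟨key _ _, key _ _⟩
    · rw [mem_preimage, geodesicFlow_of_not_isGeodesicVector hv]
  · refine disjoint_left.mpr ?_
    rintro v ⟨-, h⟩ ⟨-, h'⟩
    rw [h, mul_zero] at h'
    exact lt_irrefl _ h'

/-- The flow moves, with a suitable delay, a cell over a short interval out of this interval.
The vectors of the cell that are not tangent to a complete geodesic, if any, form an invariant set
and are negligible by ergodicity, so completeness of `M` is not needed. -/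
lemma measure_cell_le (hμ : IsInvariantErgodic μ) (hμ' : HasFullSupport μ) {x ε : ℝ}
    (hε : 0 < ε) (hx : x + 6 * ε < C.l) (i : ℤ × ℤˣ) :
    (μ : Measure (UnitTangentBundle M)) (C.cell (Ioo (x - ε) (x + ε)) i) ≤
      (μ : Measure (UnitTangentBundle M)) (C.cell (Ioo (x - ε) (x + ε))ᶜ i) := by
  obtain ⟨k, σ⟩ := i
  set I := Ioo (x - ε) (x + ε) with hI
  -- The axial speed lies in `(2 ^ k, 2 ^ (k + 1)]`, so this time gives a displacement in `(5 / 2 *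
  -- ε, 5 * ε]`: more than the length `2 * ε` of `I`, and short enough to end below `x + 6 * ε`. The
  -- sign `σ` in `t` makes the motion increase `coord` in every cell, running the flow backwards for
  -- negative slopes.
  set t : ℝ := ((σ : ℤ) : ℝ) * (5 / 2 * ε * ((2 : ℝ) ^ k)⁻¹) with ht
  have hmove : ∀ v ∈ C.cell I (k, σ), IsGeodesicVector v →
      geodesicFlow t v ∈ C.cell Iᶜ (k, σ) := by
    rintro v ⟨hvC, hvI, hvs⟩ hv
    obtain ⟨γ, hγ, rfl, hflow⟩ := hv.exists_flow_eq
    change γ 0 ∈ C.interior at hvC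
    change C.coord (γ 0) ∈ I at hvI
    change ((σ : ℤ) : ℝ) * C.slope ⟨γ 0, curveDeriv γ 0⟩ ∈ Ioc ((2 : ℝ) ^ k) (2 ^ (k + 1)) at hvs
    have h0 := C.coord_mem_Ioo hvC
    set c := C.slope ⟨γ 0, curveDeriv γ 0⟩ with hc
    have h2 : (0 : ℝ) < 2 ^ k := zpow_pos two_pos k
    have hdisp : (t - 0) * c ∈ Ioc (5 / 2 * ε) (5 * ε) := by
      have h3 : (t - 0) * c = 5 / 2 * ε * ((((σ : ℤ) : ℝ) * c) / 2 ^ k) := by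
        rw [ht]; field_simp; ring
      have h4 : 1 < (((σ : ℤ) : ℝ) * c) / 2 ^ k := (one_lt_div h2).mpr hvs.1
      have h5 : (((σ : ℤ) : ℝ) * c) / 2 ^ k ≤ 2 := by
        rw [div_le_iff₀ h2, ← zpow_one_add₀ two_ne_zero, add_comm]
        exact hvs.2
      rw [h3]
      constructor <;> nlinarith
    have h6 := hγ.affine C (t₀ := 0) (t := t) hvC
      ⟨by linarith [h0.1, hdisp.1], by linarith [hvI.2, hdisp.2]⟩
    rw [hflow]
    refine ⟨h6.1, ?_, ?_⟩
    · change C.coord (γ t) ∈ Iᶜ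
      rw [h6.2.1]
      intro h7
      linarith [h7.2, hvI.1, hdisp.1]
    · change ((σ : ℤ) : ℝ) * C.slope ⟨γ t, curveDeriv γ t⟩ ∈ Ioc ((2 : ℝ) ^ k) (2 ^ (k + 1))
      rw [h6.2.2]
      exact hvs
  have hAm := C.measurableSet_cell (s := I) measurableSet_Ioo (k, σ)
  have hBm := C.measurableSet_cell (s := Iᶜ) measurableSet_Ioo.compl (k, σ)
  -- Vectors tangent to a complete geodesic leave the cell over `I`, while the flow fixes the
  -- others. The latter are thus exactly `F`, which is measurable by this description.
  set F := C.cell I (k, σ) ∩ geodesicFlow t ⁻¹' C.cell I (k, σ) with hF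
  have hFm : MeasurableSet F := hAm.inter ((hμ.invariant t).measurable hAm)
  have hFG : ∀ v ∈ F, ¬ IsGeodesicVector v := fun v hv hG => (hmove v hv.1 hG).2.1 hv.2.2.1
  have hF0 : (μ : Measure (UnitTangentBundle M)) F = 0 := by
    -- Slopes in the cell have sign `σ`, so the open set of vectors of the opposite sign is disjoint
    -- from `F`.
    refine measure_eq_zero_of_disjoint hμ hμ' hFm (geodesicFlow_preimage_eq hFG)
      (C.isOpen_pos_slope (-σ)) (C.nonempty_pos_slope (-σ)) (disjoint_left.mpr ?_)
    rintro v ⟨⟨-, -, h⟩, -⟩ ⟨-, h'⟩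
    have h3 := (zpow_pos (two_pos (α := ℝ)) k).trans h.1
    push_cast at h'
    linarith
  have hsub : C.cell I (k, σ) ⊆ geodesicFlow t ⁻¹' C.cell Iᶜ (k, σ) ∪ F := by
    intro v hv
    by_cases hG : IsGeodesicVector v
    · exact Or.inl (hmove v hv hG)
    · refine Or.inr ⟨hv, ?_⟩
      rwa [mem_preimage, geodesicFlow_of_not_isGeodesicVector hG]
  calc (μ : Measure (UnitTangentBundle M)) (C.cell I (k, σ))
      ≤ (μ : Measure (UnitTangentBundle M)) (geodesicFlow t ⁻¹' C.cell Iᶜ (k, σ)) +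
        (μ : Measure (UnitTangentBundle M)) F := (measure_mono hsub).trans (measure_union_le _ _)
    _ = (μ : Measure (UnitTangentBundle M)) (C.cell Iᶜ (k, σ)) := by
        rw [hF0, add_zero, (hμ.invariant t).measure_preimage hBm.nullMeasurableSet]

/-- An ergodic measure of full support gives mass at most `1 / 2` to the unit vectors over a
sufficiently narrow part of a flat cylinder. -/
lemma measureReal_le_half (hμ : IsInvariantErgodic μ) (hμ' : HasFullSupport μ) {x ε : ℝ}
    (hε : 0 < ε) (hx : x + 6 * ε < C.l) :
    (μ : Measure (UnitTangentBundle M)).real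
      {v ∈ C.unitVectors | C.coord v.1.proj ∈ Ioo (x - ε) (x + ε)} ≤ 1 / 2 := by
  set I := Ioo (x - ε) (x + ε)
  set A : Set (UnitTangentBundle M) := {v ∈ C.unitVectors | C.coord v.1.proj ∈ I} with hA
  have hAm : MeasurableSet A := measurableSet_inter_preimage C.isOpen_unitVectors
    C.continuousOn_coord_unitVectors measurableSet_Ioo
  have hsub : A ⊆ {v ∈ C.unitVectors | C.slope v.1 = 0} ∪ ⋃ i, C.cell I i := by
    rintro v ⟨hv, hvI⟩
    by_cases h0 : C.slope v.1 = 0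
    · exact Or.inl ⟨hv, h0⟩
    · exact Or.inr (mem_iUnion.mpr (C.mem_cell_of_slope_ne_zero hv hvI h0))
  -- Subadditivity suffices over `I`; over the complement of `I` the disjointness of the cells turns
  -- the sum back into a measure.
  have hle : (μ : Measure (UnitTangentBundle M)) A ≤ (μ : Measure (UnitTangentBundle M)) Aᶜ := calc
    (μ : Measure (UnitTangentBundle M)) A
      ≤ (μ : Measure (UnitTangentBundle M)) {v ∈ C.unitVectors | C.slope v.1 = 0} +
        (μ : Measure (UnitTangentBundle M)) (⋃ i, C.cell I i) :=
        (measure_mono hsub).trans (measure_union_le _ _)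
    _ ≤ ∑' i, (μ : Measure (UnitTangentBundle M)) (C.cell I i) := by
        rw [C.measure_slope_eq_zero hμ hμ', zero_add]
        exact measure_iUnion_le _
    _ ≤ ∑' i, (μ : Measure (UnitTangentBundle M)) (C.cell Iᶜ i) :=
        ENNReal.tsum_le_tsum (C.measure_cell_le hμ hμ' hε hx)
    _ = (μ : Measure (UnitTangentBundle M)) (⋃ i, C.cell Iᶜ i) :=
        (measure_iUnion (C.pairwise_disjoint_cell _)
          (C.measurableSet_cell measurableSet_Ioo.compl)).symm
    _ ≤ (μ : Measure (UnitTangentBundle M)) Aᶜ :=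
        measure_mono (iUnion_subset fun _ _ hv hvA => hv.2.1 hvA.2)
  have h1 : (μ : Measure (UnitTangentBundle M)).real A ≤
      (μ : Measure (UnitTangentBundle M)).real Aᶜ :=
    ENNReal.toReal_mono (measure_ne_top _ _) hle
  rw [probReal_compl_eq_one_sub hAm] at h1
  linarith

end EmbeddedFlatCylinder

/-- A closed geodesic contained in a flat cylinder is orthogonal to its axis. -/
lemma IsUnitSpeedGeodesic.coord_eq_of_periodic {γ : ℝ → M} (hγ : IsUnitSpeedGeodesic γ)
    (C : EmbeddedFlatCylinder M) {T : ℝ} (hT : 0 < T) (hper : Function.Periodic γ T)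
    (hC : ∀ t, γ t ∈ C.interior) (t : ℝ) : C.coord (γ t) = C.coord (γ 0) := by
  set c := C.slope ⟨γ 0, curveDeriv γ 0⟩
  have hslope : ∀ s, C.slope ⟨γ s, curveDeriv γ s⟩ = c := fun s =>
    is_const_of_deriv_eq_zero (f := fun s => C.slope ⟨γ s, curveDeriv γ s⟩)
      (fun u => (hγ.hasDerivAt_slope C (hC u)).differentiableAt)
      (fun u => (hγ.hasDerivAt_slope C (hC u)).deriv) s 0
  have hd : ∀ s, HasDerivAt (fun s => C.coord (γ s) - s * c) 0 s := fun s => by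
    have := (hγ.hasDerivAt_coord C (hC s)).sub ((hasDerivAt_id s).mul_const c)
    rw [hslope, one_mul, sub_self] at this
    exact this
  have haff : ∀ s, C.coord (γ s) = C.coord (γ 0) + s * c := fun s => by
    have := is_const_of_deriv_eq_zero (fun u => (hd u).differentiableAt) (fun u => (hd u).deriv) s 0
    simp only [zero_mul, sub_zero] at this
    linarith
  -- Over one period the axial displacement is both `T * c` and zero.
  have hc : c = 0 := by
    have h1 := haff T
    have h2 : γ T = γ 0 := by simpa using hper 0
    rw [h2] at h1
    have : T * c = 0 := by linarith
    exact (mul_eq_zero.mp this).resolve_left hT.ne'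
  rw [haff t, hc, mul_zero, add_zero]

/-- The integral of a function which is constant along a closed geodesic. -/
lemma integral_orbitMeasure_eq {γ : ℝ → M} (hγ : IsUnitSpeedGeodesic γ) {T : ℝ} (hT : 0 < T)
    {f : UnitTangentBundle M → ℝ} (hf : Continuous f) {c : ℝ} (hc : ∀ t, f (velocity hγ t) = c) :
    ∫ v, f v ∂(orbitMeasure hγ T hT : Measure (UnitTangentBundle M)) = c := by
  have h : ∀ᵐ v ∂(orbitMeasure hγ T hT : Measure (UnitTangentBundle M)), f v = c := by
    refine (ae_map_iff (continuous_velocity hγ).measurable.aemeasurable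
      (hf.measurable (measurableSet_singleton c))).mpr (ae_of_all _ hc)
  rw [integral_congr_ae h]
  simp

end Measures

end RiemannianSurface

end

/-! ### Separation by a test function -/

open RiemannianSurface in
theorem theorem7 {M : Type*} [TopologicalSpace M] [T2Space M] [CompactSpace M]
    [ChartedSpace RiemannianSurface.Plane M] [IsManifold (𝓡 2) ∞ M]
    [RiemannianBundle (fun x : M => TangentSpace (𝓡 2) x)]
    [IsContMDiffRiemannianBundle (𝓡 2) ∞ RiemannianSurface.Plane
      (fun x : M => TangentSpace (𝓡 2) x)]
    (C : RiemannianSurface.EmbeddedFlatCylinder M)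
    (γ : ℝ → M) (hγ : RiemannianSurface.IsUnitSpeedGeodesic γ)
    (T : ℝ) (hT : 0 < T) (hper : Function.Periodic γ T) (hC : ∀ t : ℝ, γ t ∈ C.interior) :
    RiemannianSurface.orbitMeasure hγ T hT ∉
      closure {μ : ProbabilityMeasure (RiemannianSurface.UnitTangentBundle M) |
        RiemannianSurface.IsInvariantErgodic μ ∧ RiemannianSurface.HasFullSupport μ} := by
  have hx := C.coord_mem_Ioo (hC 0)
  set x := C.coord (γ 0) with hxdef
  -- Chosen so that `x + 6 * ε < l`. The left end `x - ε` may be negative, which is harmless since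
  -- cells move only to the right.
  set ε := (C.l - x) / 7 with hε
  have hε0 : 0 < ε := by linarith [hx.2]
  have hεl : x + 6 * ε < C.l := by linarith [hx.2]
  -- Urysohn function equal to `1` on the circle `coord = x`, closed as the image over `[x, x]`, and
  -- to `0` off the open band of half-width `ε`.
  obtain ⟨f, hf0, hf1, hf⟩ := exists_continuous_zero_one_of_isClosed
    (C.isOpen_inter_coord_preimage (isOpen_Ioo (a := x - ε) (b := x + ε))).isClosed_compl
    (C.isClosed_image_Icc (a := x) (b := x) hx.1.le hx.2.le) (by
      refine disjoint_left.mpr ?_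
      rintro _ hm ⟨p, hp, rfl⟩
      have hpx : p 0 = x := le_antisymm hp.2 hp.1
      have hpI : p 0 ∈ Ioo 0 C.l := hpx ▸ hx
      refine hm ⟨⟨p, hpI, rfl⟩, ?_⟩
      rw [mem_preimage, C.coord_apply (Ioo_subset_Icc_self hpI), hpx]
      constructor <;> linarith)
  let g : BoundedContinuousFunction (UnitTangentBundle M) ℝ :=
    (BoundedContinuousFunction.mkOfCompact f).compContinuous ⟨_, continuous_basePoint⟩
  have hg : ∀ v, g v = f v.1.proj := fun _ => rfl
  have hclosed : IsClosed {μ : ProbabilityMeasure (UnitTangentBundle M) |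
      ∫ v, g v ∂(μ : Measure (UnitTangentBundle M)) ≤ 1 / 2} :=
    isClosed_le (ProbabilityMeasure.continuous_integral_boundedContinuousFunction g)
      continuous_const
  intro hmem
  have hle := closure_minimal (t := {μ : ProbabilityMeasure (UnitTangentBundle M) |
      ∫ v, g v ∂(μ : Measure (UnitTangentBundle M)) ≤ 1 / 2}) ?_ hclosed hmem
  · have h1 := integral_orbitMeasure_eq hγ hT g.continuous (c := 1) fun t => by
      obtain ⟨p, hp, hpt⟩ := hC t
      refine hf1 ⟨p, ?_, hpt⟩
      have h2 := hγ.coord_eq_of_periodic C hT hper hC t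
      rw [← hpt, C.coord_apply (Ioo_subset_Icc_self hp)] at h2
      exact ⟨h2.ge, h2.le⟩
    rw [mem_ofPred_eq, h1] at hle
    norm_num at hle
  -- The lift `g` is at most the indicator of the unit vectors over the band, so its integral is at
  -- most their mass.
  · rintro μ ⟨hμ, hμ'⟩
    refine le_trans ?_ (C.measureReal_le_half hμ hμ' hε0 hεl)
    have hAm : MeasurableSet {v ∈ C.unitVectors | C.coord v.1.proj ∈ Ioo (x - ε) (x + ε)} :=
      measurableSet_inter_preimage C.isOpen_unitVectors C.continuousOn_coord_unitVectors
        measurableSet_Ioo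
    rw [← integral_indicator_one hAm]
    refine integral_mono (g.integrable _) ((integrable_const 1).indicator hAm) fun v => ?_
    by_cases hv : v ∈ {v ∈ C.unitVectors | C.coord v.1.proj ∈ Ioo (x - ε) (x + ε)}
    · rw [indicator_of_mem hv]
      exact (hf _).2
    · rw [indicator_of_notMem hv]
      exact (hf0 hv).le
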